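/- Let $K$ be a skew field, $\sigma\colon K\to K$ a ring endomorphism and $\delta\colon K\to K$ a $\sigma$-derivation, i.e. an additive map with $\delta(xy)=\sigma(x)\delta(y)+\delta(x)y$. Let $R=K[T;\sigma,\delta]$ be the skew polynomial ring, in which $Tx=\sigma(x)T+\delta(x)$ for $x\in K$, and let $K(T;\sigma,\delta)$ be its skew field of left fractions $P^{-1}Q$. For $P\in R$ and $c\in K$, the value $P(c)\in K$ is the remainder of $P$ on right division by $T-c$, i.e. $P-P(c)\in R(T-c)$; $c$ is a right root of $P$ if $P(c)=0$. The group $K^*$ acts on $K$ by ${}^{b}a=\sigma(b)ab^{-1}+\delta(b)b^{-1}$; the orbit $\Delta^{\sigma,\delta}(a)$ of $a$ is its $(\sigma,\delta)$-conjugacy class, and it is called $(\sigma,\delta)$-algebraic if some nonzero $P\in R$ vanishes at all of its elements. Functions $f,g\colon \Delta^{\sigma,\delta}(a)\to K$ are multiplied by the skew product: $(f\diamond g)(x)=f({}^{g(x)}x)\,g(x)$ if $g(x)\ne0$, and $(f\diamond g)(x)=0$ if $g(x)=0$. A function is skew invertible if it has a two-sided inverse for $\diamond$ with respect to the constant function $1$.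 The minimal representation of $f\in K(T;\sigma,\delta)$ is the representation $f=P^{-1}Q$ ($P,Q\in R$, $P\neq 0$) in which $P$ is monic and of least degree among the denominators of all such representations; $f$ is defined at $a$ if $P$ is skew invertible as a function on $\Delta^{\sigma,\delta}(a)$. Let $\mathrm{Def}(a)$ be the set of all $f\in K(T;\sigma,\delta)$ that are defined at $a$. Call $S\subseteq R$ a left Ore subset if $SQ\cap RP\neq\emptyset$ for all $P\in S$ and $Q\in R$ (unions of left Ore subsets are left Ore subsets). Let $S(a)$ be the largest left Ore subset of $R$ such that for every $P\in S(a)$ and every monic irreducible $Q\in R$ with $P=Q_1QQ_2$ for some $Q_1,Q_2\in R$ one has $Q^{-1}\in \mathrm{Def}(a)$. Put $\mathrm{Def}_o(a)=S(a)^{-1}R=\{P^{-1}Q : P\in S(a),\ Q\in R\}\subseteq K(T;\sigma,\delta)$. **Theorem.** Let $a\in K$ and assume that $\Delta^{\sigma,\delta}(a)$ is $(\sigma,\delta)$-algebraic. Then a skew polynomial $P\in R$ belongs to $S(a)$ if and only if $P$ has no right root in $\Delta^{\sigma,\delta}(a)$. In particular, $S(a)$ contains $1$ and is closed under multiplication (so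 it is a multiplicative left Ore set, and $\mathrm{Def}_o(a)$ is the Ore localization of $R$ at $S(a)$), and $\mathrm{Def}_o(a)=\mathrm{Def}(a)$. -/

import Mathlib

noncomputable section

/-- A `σ`-derivation of a ring `K`: an additive map `δ` with `δ (a b) = σ(a) δ(b) + δ(a) b`. -/
structure SkewDerivation {K : Type*} [Ring K] (σ : K →+* K) extends K →+ K where
  leibniz' : ∀ a b : K, toFun (a * b) = σ a * toFun b + toFun a * b

namespace SkewDerivation

variable {K : Type*} [Ring K] {σ : K →+* K}

instance : CoeFun (SkewDerivation σ) (fun _ => K → K) := ⟨fun δ => δ.toFun⟩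

theorem leibniz (δ : SkewDerivation σ) (a b : K) : δ (a * b) = σ a * δ b + δ a * b :=
  δ.leibniz' a b

@[simp] theorem map_one (δ : SkewDerivation σ) : δ 1 = 0 := by
  have h := δ.leibniz 1 1
  simpa using h

end SkewDerivation

/-- The skew polynomials `∑ aᵢ Tⁱ` over `K`, given by their finitely many non-zero (left)
coefficients. -/
def SkewPoly {K : Type*} [Ring K] (σ : K →+* K) (_δ : SkewDerivation σ) : Type _ := ℕ →₀ K

namespace SkewPoly

section Ring

variable {K : Type*} [Ring K] {σ : K →+* K} {δ : SkewDerivation σ}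

instance : AddCommGroup (SkewPoly σ δ) := inferInstanceAs (AddCommGroup (ℕ →₀ K))

instance : Module K (SkewPoly σ δ) := inferInstanceAs (Module K (ℕ →₀ K))

/-- The coefficient of `Tⁿ`. -/
def coeff (n : ℕ) : SkewPoly σ δ →+ K := Finsupp.applyAddHom (M := K) n

/-- The skew polynomial `a Tⁿ`. -/
def monomial (n : ℕ) : K →+ SkewPoly σ δ := Finsupp.singleAddHom (M := K) n

/-- Additive maps out of the skew polynomials are given by their values on monomials. -/
def liftAdd {A : Type*} [AddCommMonoid A] (f : ℕ → K →+ A) : SkewPoly σ δ →+ A :=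
  Finsupp.liftAddHom (M := K) f

theorem liftAdd_monomial {A : Type*} [AddCommMonoid A] (f : ℕ → K →+ A) (n : ℕ) (a : K) :
    liftAdd f (monomial n a : SkewPoly σ δ) = f n a :=
  Finsupp.liftAddHom_apply_single (M := K) f n a

theorem addHom_ext {A : Type*} [AddCommMonoid A] {f g : SkewPoly σ δ →+ A}
    (h : ∀ n a, f (monomial n a) = g (monomial n a)) : f = g :=
  Finsupp.addHom_ext (M := K) h

theorem induction_linear {motive : SkewPoly σ δ → Prop} (P : SkewPoly σ δ) (zero : motive 0)
    (add : ∀ F G, motive F → motive G → motive (F + G))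
    (monomial : ∀ n a, motive (monomial n a)) : motive P :=
  Finsupp.induction_linear (M := K) P zero (fun F G => add F G) monomial

theorem coeff_monomial (n k : ℕ) (a : K) :
    coeff k (monomial n a : SkewPoly σ δ) = if n = k then a else 0 :=
  Finsupp.single_apply (M := K)

theorem smul_monomial (a : K) (n : ℕ) (b : K) :
    a • (monomial n b : SkewPoly σ δ) = monomial n (a * b) :=
  Finsupp.smul_single (M := K) a n b

theorem coeff_smul (a : K) (k : ℕ) (P : SkewPoly σ δ) : coeff k (a • P) = a * coeff k P :=
  Finsupp.smul_apply (M := K) a P k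

@[ext] theorem ext {P Q : SkewPoly σ δ} (h : ∀ k, coeff k P = coeff k Q) : P = Q :=
  Finsupp.ext (M := K) h

variable (σ δ) in
/-- Left multiplication by `T`: `T (a Tⁱ) = σ(a) Tⁱ⁺¹ + δ(a) Tⁱ`. -/
def mulT : AddMonoid.End (SkewPoly σ δ) :=
  liftAdd fun i => (monomial (i + 1)).comp σ.toAddMonoidHom + (monomial i).comp δ.toAddMonoidHom

theorem mulT_monomial (i : ℕ) (a : K) :
    mulT σ δ (monomial i a) = monomial (i + 1) (σ a) + monomial i (δ a) :=
  liftAdd_monomial _ i a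

/-- Left multiplication by `∑ aᵢ Tⁱ`, as the operator `∑ aᵢ (mulT)ⁱ`. -/
def mulLeft : SkewPoly σ δ →+ AddMonoid.End (SkewPoly σ δ) :=
  liftAdd fun i => (AddMonoidHom.mulRight (mulT σ δ ^ i)).comp
    (Module.toAddMonoidEnd K (SkewPoly σ δ)).toAddMonoidHom

theorem mulLeft_monomial (i : ℕ) (a : K) (Q : SkewPoly σ δ) :
    mulLeft (monomial i a) Q = a • (mulT σ δ ^ i) Q :=
  congrArg (fun F : AddMonoid.End (SkewPoly σ δ) => F Q) (liftAdd_monomial _ i a)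

/-- The product of skew polynomials, determined by `T a = σ(a) T + δ(a)`. -/
instance : Mul (SkewPoly σ δ) := ⟨fun P Q => mulLeft P Q⟩

instance : One (SkewPoly σ δ) := ⟨monomial 0 1⟩

theorem mul_def (P Q : SkewPoly σ δ) : P * Q = mulLeft P Q := rfl

theorem one_def : (1 : SkewPoly σ δ) = monomial 0 1 := rfl

theorem mulT_smul (a : K) (Q : SkewPoly σ δ) :
    mulT σ δ (a • Q) = σ a • mulT σ δ Q + δ a • Q := by
  let e := Module.toAddMonoidEnd K (SkewPoly σ δ)
  have h : mulT σ δ * e a = e (σ a) * mulT σ δ + e (δ a) := by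
    refine addHom_ext (A := SkewPoly σ δ) fun n b => ?_
    change mulT σ δ (a • monomial n b) = σ a • mulT σ δ (monomial n b) + δ a • monomial n b
    simp only [smul_monomial, mulT_monomial, smul_add, map_mul, δ.leibniz, map_add]
    abel
  exact DFunLike.congr_fun h Q

theorem mulLeft_smul (a : K) (P Q : SkewPoly σ δ) : mulLeft (a • P) Q = a • mulLeft P Q := by
  let e := Module.toAddMonoidEnd K (SkewPoly σ δ)
  have h : (mulLeft (σ := σ) (δ := δ)).comp (e a) =
      (AddMonoidHom.mulLeft (e a)).comp (mulLeft (σ := σ) (δ := δ)) := by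
    refine addHom_ext fun n b => ?_
    refine DFunLike.ext _ _ fun R => ?_
    change mulLeft (a • monomial n b) R = a • mulLeft (monomial n b) R
    simp only [smul_monomial, mulLeft_monomial, mul_smul]
  exact DFunLike.congr_fun (DFunLike.congr_fun h P) Q

theorem mulLeft_mulT (P Q : SkewPoly σ δ) :
    mulLeft (mulT σ δ P) Q = mulT σ δ (mulLeft P Q) := by
  have h : (mulLeft (σ := σ) (δ := δ)).comp (mulT σ δ) =
      (AddMonoidHom.mulLeft (mulT σ δ)).comp (mulLeft (σ := σ) (δ := δ)) := by
    refine addHom_ext fun n b => ?_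
    refine DFunLike.ext _ _ fun R => ?_
    change mulLeft (mulT σ δ (monomial n b)) R = mulT σ δ (mulLeft (monomial n b) R)
    rw [mulT_monomial, map_add]
    change mulLeft (monomial (n + 1) (σ b)) R + mulLeft (monomial n (δ b)) R = _
    rw [mulLeft_monomial, mulLeft_monomial, mulLeft_monomial, mulT_smul, pow_succ']
    rfl
  exact DFunLike.congr_fun (DFunLike.congr_fun h P) Q

theorem mulLeft_mulT_pow (i : ℕ) (P Q : SkewPoly σ δ) :
    mulLeft ((mulT σ δ ^ i) P) Q = (mulT σ δ ^ i) (mulLeft P Q) := by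
  induction i with
  | zero => rfl
  | succ i ih =>
    rw [pow_succ']
    change mulLeft (mulT σ δ ((mulT σ δ ^ i) P)) Q = mulT σ δ ((mulT σ δ ^ i) (mulLeft P Q))
    rw [mulLeft_mulT, ih]

theorem mulLeft_mulLeft (P Q R : SkewPoly σ δ) :
    mulLeft (mulLeft P Q) R = mulLeft P (mulLeft Q R) := by
  have h : (AddMonoidHom.flip (mulLeft (σ := σ) (δ := δ)) R).comp
      (AddMonoidHom.flip (mulLeft (σ := σ) (δ := δ)) Q) =
      AddMonoidHom.flip (mulLeft (σ := σ) (δ := δ)) (mulLeft Q R) := by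
    refine addHom_ext fun n b => ?_
    change mulLeft (mulLeft (monomial n b) Q) R = mulLeft (monomial n b) (mulLeft Q R)
    rw [mulLeft_monomial, mulLeft_monomial, mulLeft_smul, mulLeft_mulT_pow]
  exact DFunLike.congr_fun h P

theorem mulT_pow_one (i : ℕ) : (mulT σ δ ^ i) (monomial 0 1) = monomial i 1 := by
  induction i with
  | zero => rfl
  | succ i ih =>
    rw [pow_succ']
    change mulT σ δ ((mulT σ δ ^ i) (monomial 0 1)) = _
    rw [ih, mulT_monomial, map_one, δ.map_one, map_zero, add_zero]

theorem mulLeft_one_right (P : SkewPoly σ δ) : mulLeft P (monomial 0 1) = P := by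
  have h : AddMonoidHom.flip (mulLeft (σ := σ) (δ := δ)) (monomial 0 1) =
      AddMonoidHom.id (SkewPoly σ δ) := by
    refine addHom_ext fun n b => ?_
    change mulLeft (monomial n b) (monomial 0 1) = monomial n b
    rw [mulLeft_monomial, mulT_pow_one, smul_monomial, mul_one]
  exact DFunLike.congr_fun h P

/-- The skew polynomial ring `K[T; σ, δ]`. -/
instance : Ring (SkewPoly σ δ) :=
  { (inferInstance : AddCommGroup (SkewPoly σ δ)),
    (inferInstance : Mul (SkewPoly σ δ)),
    (inferInstance : One (SkewPoly σ δ)) with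
    left_distrib := fun P Q R => map_add (mulLeft P) Q R
    right_distrib := fun P Q R => DFunLike.congr_fun (map_add mulLeft P Q) R
    zero_mul := fun P => DFunLike.congr_fun (map_zero mulLeft) P
    mul_zero := fun P => map_zero (mulLeft P)
    mul_assoc := fun P Q R => mulLeft_mulLeft P Q R
    one_mul := fun P => by
      change mulLeft (monomial 0 1) P = P
      rw [mulLeft_monomial, one_smul]
      rfl
    mul_one := fun P => mulLeft_one_right P }

/-- The embedding of `K` as the constant skew polynomials. -/
def C : K →+ SkewPoly σ δ := monomial 0

variable (σ δ) in
/-- The variable `T`. -/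
def T : SkewPoly σ δ := monomial 1 1

theorem C_mul (a : K) (P : SkewPoly σ δ) : C a * P = a • P := by
  change mulLeft (monomial 0 a) P = a • P
  rw [mulLeft_monomial]
  rfl

theorem T_mul (P : SkewPoly σ δ) : T σ δ * P = mulT σ δ P := by
  change mulLeft (monomial 1 1) P = _
  rw [mulLeft_monomial, one_smul, pow_one]

/-- The defining relation `T a = σ(a) T + δ(a)`. -/
theorem T_mul_C (a : K) : T σ δ * C a = C (σ a) * T σ δ + C (δ a) := by
  rw [T_mul, C_mul]
  change mulT σ δ (monomial 0 a) = σ a • monomial 1 1 + monomial 0 (δ a)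
  rw [mulT_monomial, smul_monomial, mul_one]

theorem monomial_eq (n : ℕ) (a : K) : (monomial n a : SkewPoly σ δ) = C a * T σ δ ^ n := by
  have h : ∀ n : ℕ, T σ δ ^ n = monomial n 1 := by
    intro n
    induction n with
    | zero => rfl
    | succ n ih =>
      rw [pow_succ', T_mul, ih, mulT_monomial, map_one, δ.map_one, map_zero, add_zero]
  rw [h, C_mul, smul_monomial, mul_one]

/-- The degree of a skew polynomial, with value `0` at the zero polynomial. -/
def natDegree (P : SkewPoly σ δ) : ℕ := (Finsupp.support (M := K) P).sup id

/-- A skew polynomial is monic if its leading coefficient is `1`. -/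
def Monic (P : SkewPoly σ δ) : Prop := coeff P.natDegree P = 1

/-- The values at `a` of the powers of `T`: `N₀(a) = 1` and
`Nᵢ₊₁(a) = σ(Nᵢ(a)) a + δ(Nᵢ(a))`. -/
def powEval (δ : SkewDerivation σ) (a : K) : ℕ → K
  | 0 => 1
  | i + 1 => σ (powEval δ a i) * a + δ (powEval δ a i)

/-- The value `P(a) = ∑ aᵢ Nᵢ(a)` of the skew polynomial `P = ∑ aᵢ Tⁱ` at `a`. -/
def eval (a : K) : SkewPoly σ δ →+ K :=
  liftAdd fun i => AddMonoidHom.mulRight (powEval δ a i)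

/-- `P(a)` is the remainder of `P` on right division by `T - a`. -/
theorem exists_sub_eval_eq_mul (a : K) (P : SkewPoly σ δ) :
    ∃ Q : SkewPoly σ δ, P - C (eval a P) = Q * (T σ δ - C a) := by
  have key : ∀ i : ℕ, ∃ Q : SkewPoly σ δ, T σ δ ^ i - C (powEval δ a i) = Q * (T σ δ - C a) := by
    intro i
    induction i with
    | zero => exact ⟨0, by rw [zero_mul, sub_eq_zero]; rfl⟩
    | succ i ih =>
      obtain ⟨Q, hQ⟩ := ih
      refine ⟨T σ δ * Q + C (σ (powEval δ a i)), ?_⟩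
      have hC : (C (σ (powEval δ a i) * a) : SkewPoly σ δ) = C (σ (powEval δ a i)) * C a := by
        rw [C_mul]; exact (smul_monomial _ _ _).symm
      rw [add_mul, mul_assoc, ← hQ, mul_sub, mul_sub, T_mul_C, powEval, map_add, hC, pow_succ']
      abel
  induction P using induction_linear with
  | zero => exact ⟨0, by simp⟩
  | add F G hF hG =>
    obtain ⟨A, hA⟩ := hF
    obtain ⟨B, hB⟩ := hG
    exact ⟨A + B, by rw [add_mul, ← hA, ← hB, map_add, map_add]; abel⟩
  | monomial n b =>
    obtain ⟨Q, hQ⟩ := key n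
    have he : eval a (monomial n b : SkewPoly σ δ) = b * powEval δ a n := liftAdd_monomial _ n b
    have hC : (C (b * powEval δ a n) : SkewPoly σ δ) = C b * C (powEval δ a n) := by
      rw [C_mul]; exact (smul_monomial _ _ _).symm
    exact ⟨C b * Q, by rw [mul_assoc, ← hQ, mul_sub, he, hC, monomial_eq]⟩

theorem coeff_mulT_zero (P : SkewPoly σ δ) : coeff 0 (mulT σ δ P) = δ (coeff 0 P) := by
  have h : (coeff 0).comp (mulT σ δ) = δ.toAddMonoidHom.comp (coeff (σ := σ) (δ := δ) 0) := by
    refine addHom_ext fun n b => ?_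
    change coeff 0 (mulT σ δ (monomial n b)) = δ.toAddMonoidHom (coeff 0 (monomial n b))
    rw [mulT_monomial, map_add, coeff_monomial, coeff_monomial, coeff_monomial]
    split_ifs <;> simp_all
  exact DFunLike.congr_fun h P

theorem coeff_mulT_succ (k : ℕ) (P : SkewPoly σ δ) :
    coeff (k + 1) (mulT σ δ P) = σ (coeff k P) + δ (coeff (k + 1) P) := by
  have h : (coeff (k + 1)).comp (mulT σ δ) = σ.toAddMonoidHom.comp (coeff (σ := σ) (δ := δ) k) +
      δ.toAddMonoidHom.comp (coeff (σ := σ) (δ := δ) (k + 1)) := by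
    refine addHom_ext fun n b => ?_
    change coeff (k + 1) (mulT σ δ (monomial n b)) = σ (coeff k (monomial n b)) +
      δ.toAddMonoidHom (coeff (k + 1) (monomial n b))
    rw [mulT_monomial, map_add, coeff_monomial, coeff_monomial, coeff_monomial, coeff_monomial]
    split_ifs <;> simp_all
  exact DFunLike.congr_fun h P

/-- All coefficients of `P` from `Tⁿ` on vanish. -/
def DegLT (n : ℕ) (P : SkewPoly σ δ) : Prop := ∀ k, n ≤ k → coeff k P = 0

theorem exists_degLT (P : SkewPoly σ δ) : ∃ n, DegLT n P := by
  refine ⟨P.natDegree + 1, fun k hk => ?_⟩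
  by_contra h
  have : k ∈ Finsupp.support (M := K) P := Finsupp.mem_support_iff.mpr h
  have := Finset.le_sup (f := id) this
  change k ≤ natDegree P at this
  omega

theorem mulT_pow_top {m : ℕ} {P : SkewPoly σ δ} (h : DegLT (m + 1) P) (i : ℕ) :
    DegLT (m + i + 1) ((mulT σ δ ^ i) P) ∧
      coeff (m + i) ((mulT σ δ ^ i) P) = σ^[i] (coeff m P) := by
  induction i with
  | zero => exact ⟨h, rfl⟩
  | succ i ih =>
    obtain ⟨h1, h2⟩ := ih
    rw [pow_succ', Function.iterate_succ_apply', ← h2]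
    have hz : δ 0 = 0 := map_zero δ.toAddMonoidHom
    constructor
    · intro k hk
      obtain ⟨k, rfl⟩ : ∃ j, k = j + 1 := ⟨k - 1, by omega⟩
      change coeff (k + 1) (mulT σ δ ((mulT σ δ ^ i) P)) = 0
      rw [coeff_mulT_succ, h1 k (by omega), h1 (k + 1) (by omega), map_zero, hz, add_zero]
    · change coeff (m + i + 1) (mulT σ δ ((mulT σ δ ^ i) P)) = _
      rw [coeff_mulT_succ, h1 (m + i + 1) le_rfl, hz, add_zero]

theorem mul_eq_sum (P Q : SkewPoly σ δ) :
    P * Q = ∑ i ∈ Finsupp.support (M := K) P, coeff i P • (mulT σ δ ^ i) Q := by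
  have h : mulLeft P =
      ∑ i ∈ Finsupp.support (M := K) P, (AddMonoidHom.mulRight (mulT σ δ ^ i)).comp
        (Module.toAddMonoidEnd K (SkewPoly σ δ)).toAddMonoidHom (coeff i P) := rfl
  rw [mul_def, h]
  exact AddMonoidHom.finsetSum_apply _ _ _

theorem monomial_mul (n : ℕ) (a : K) (Q : SkewPoly σ δ) :
    monomial n a * Q = a • (mulT σ δ ^ n) Q := mulLeft_monomial n a Q

theorem coeff_mul_top {n m : ℕ} {P Q : SkewPoly σ δ} (hP : DegLT (n + 1) P)
    (hQ : DegLT (m + 1) Q) : coeff (m + n) (P * Q) = coeff n P * σ^[n] (coeff m Q) := by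
  rw [mul_eq_sum, map_sum, Finset.sum_eq_single n]
  · rw [coeff_smul, (mulT_pow_top hQ n).2]
  · intro i hi hin
    have hlt : i < n := by
      by_contra hcon
      exact Finsupp.mem_support_iff.mp hi (hP i (by omega))
    rw [coeff_smul, (mulT_pow_top hQ i).1 _ (by omega), mul_zero]
  · intro hn
    have : coeff n P = 0 := Finsupp.notMem_support_iff.mp hn
    rw [this, zero_smul, map_zero]

end Ring

section Field

variable {K : Type*} [DivisionRing K] {σ : K →+* K} {δ : SkewDerivation σ}

instance : Nontrivial (SkewPoly σ δ) := inferInstanceAs (Nontrivial (ℕ →₀ K))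

theorem exists_top {P : SkewPoly σ δ} (hP : P ≠ 0) : ∃ n, DegLT (n + 1) P ∧ coeff n P ≠ 0 := by
  classical
  have hex := exists_degLT P
  have h := Nat.find_spec hex
  have hmin := fun k => Nat.find_min (m := k) hex
  cases hn : Nat.find hex with
  | zero =>
    rw [hn] at h
    exact absurd (SkewPoly.ext fun k => h k (Nat.zero_le k)) hP
  | succ n =>
    rw [hn] at h
    refine ⟨n, h, fun h0 => hmin n (by omega) fun k hk => ?_⟩
    rcases Nat.eq_or_lt_of_le hk with rfl | hlt
    · exact h0
    · exact h k hlt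

theorem iterate_ne_zero (n : ℕ) {a : K} (ha : a ≠ 0) : σ^[n] a ≠ 0 := by
  induction n with
  | zero => exact ha
  | succ n ih => rw [Function.iterate_succ_apply']; exact (map_ne_zero σ).mpr ih

instance : NoZeroDivisors (SkewPoly σ δ) where
  eq_zero_or_eq_zero_of_mul_eq_zero := by
    intro P Q h
    by_contra hcon
    push Not at hcon
    obtain ⟨n, hn, hn0⟩ := exists_top hcon.1
    obtain ⟨m, hm, hm0⟩ := exists_top hcon.2
    have := coeff_mul_top hn hm
    rw [h, map_zero] at this
    exact mul_ne_zero hn0 (iterate_ne_zero n hm0) this.symm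

/-- Right division with remainder. -/
theorem exists_div {m : ℕ} {S : SkewPoly σ δ} (hS : DegLT (m + 1) S) (hS0 : coeff m S ≠ 0)
    (N : ℕ) (R : SkewPoly σ δ) (hR : DegLT N R) : ∃ Q, DegLT m (R - Q * S) := by
  induction N generalizing R with
  | zero => exact ⟨0, fun k _ => by rw [zero_mul, sub_zero]; exact hR k (Nat.zero_le k)⟩
  | succ N ih =>
    by_cases hN : N < m
    · exact ⟨0, fun k hk => by rw [zero_mul, sub_zero]; exact hR k (by omega)⟩
    obtain ⟨d, rfl⟩ : ∃ d, N = m + d := ⟨N - m, by omega⟩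
    let q : SkewPoly σ δ := monomial d (coeff (m + d) R * (σ^[d] (coeff m S))⁻¹)
    have htop := mulT_pow_top hS d
    obtain ⟨Q, hQ⟩ := ih (R - q * S) (by
      intro k hk
      rw [map_sub, monomial_mul, coeff_smul]
      rcases Nat.eq_or_lt_of_le hk with rfl | hlt
      · rw [htop.2, mul_assoc, inv_mul_cancel₀ (iterate_ne_zero d hS0), mul_one, sub_self]
      · rw [hR k hlt, htop.1 k hlt, mul_zero, sub_zero])
    refine ⟨q + Q, ?_⟩
    rwa [add_mul, ← sub_sub]

theorem exists_ore (n : ℕ) (R S : SkewPoly σ δ) (hS : DegLT n S) (hS0 : S ≠ 0) :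
    ∃ U V : SkewPoly σ δ, U ≠ 0 ∧ U * R = V * S := by
  induction n using Nat.strong_induction_on generalizing R S with
  | _ n ih =>
    obtain ⟨m, hm, hm0⟩ := exists_top hS0
    have hmn : m < n := by
      by_contra hcon
      exact hm0 (hS m (by omega))
    obtain ⟨N, hN⟩ := exists_degLT R
    obtain ⟨Q, hQ⟩ := exists_div hm hm0 N R hN
    by_cases h0 : R - Q * S = 0
    · exact ⟨1, Q, one_ne_zero, by rw [one_mul]; exact sub_eq_zero.mp h0⟩
    obtain ⟨U, V, hU, hUV⟩ := ih m hmn S _ hQ h0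
    refine ⟨V, V * Q + U, ?_, ?_⟩
    · rintro rfl
      rw [zero_mul] at hUV
      exact mul_ne_zero hU hS0 hUV
    · rw [add_mul, hUV]; noncomm_ring

open scoped nonZeroDivisors in
instance : OreLocalization.OreSet (SkewPoly σ δ)⁰ :=
  Classical.choice <| OreLocalization.nonempty_oreSet_iff_of_noZeroDivisors.mpr fun R S => by
    obtain ⟨n, hn⟩ := exists_degLT (S : SkewPoly σ δ)
    obtain ⟨U, V, hU, h⟩ := exists_ore n R S hn (nonZeroDivisors.coe_ne_zero S)
    exact ⟨V, ⟨U, mem_nonZeroDivisors_of_ne_zero hU⟩, h⟩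

end Field

end SkewPoly

section SkewConvex

variable {K : Type*} [DivisionRing K]

open Classical in
/-- The (left) skew product of functions on a set `X` on which `Kˣ` acts:
`(f ⋄ g)(x) = f(g(x) • x) g(x)` if `g(x) ≠ 0`, and `0` otherwise. -/
def skewMul {X : Type*} [MulAction Kˣ X] (f g : X → K) : X → K := fun x =>
  if h : g x = 0 then 0 else f (Units.mk0 (g x) h • x) * g x

/-- Invertibility with respect to the skew product. -/
def SkewInvertible {X : Type*} [MulAction Kˣ X] (f : X → K) : Prop :=
  ∃ g : X → K, skewMul f g = (fun _ => 1) ∧ skewMul g f = (fun _ => 1)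

variable {σ : K →+* K}

/-- The `(σ, δ)`-conjugate `σ(b) a b⁻¹ + δ(b) b⁻¹` of `a` by `b`. -/
def skewConj (δ : SkewDerivation σ) (b : Kˣ) (a : K) : K :=
  σ b * a * (b : K)⁻¹ + δ b * (b : K)⁻¹

theorem skewConj_one (δ : SkewDerivation σ) (a : K) : skewConj δ 1 a = a := by
  simp [skewConj]

theorem skewConj_mul (δ : SkewDerivation σ) (b c : Kˣ) (a : K) :
    skewConj δ (b * c) a = skewConj δ b (skewConj δ c a) := by
  simp only [skewConj, Units.val_mul, map_mul, δ.leibniz, mul_inv_rev]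
  have hc : (c : K) * (c : K)⁻¹ = 1 := mul_inv_cancel₀ c.ne_zero
  have h : δ b * (c : K) * ((c : K)⁻¹ * (b : K)⁻¹) = δ b * (b : K)⁻¹ := by
    rw [mul_assoc, ← mul_assoc (c : K), hc, one_mul]
  rw [add_mul, h]
  noncomm_ring

/-- The `(σ, δ)`-conjugacy class of `a`. -/
def conjClass (δ : SkewDerivation σ) (a : K) : Set K := {c | ∃ b : Kˣ, c = skewConj δ b a}

/-- The `(σ, δ)`-action of `Kˣ` on a `(σ, δ)`-conjugacy class. -/
instance conjClassAction (δ : SkewDerivation σ) (a : K) : MulAction Kˣ (conjClass δ a) where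
  smul b c := ⟨skewConj δ b c, by
    obtain ⟨_, d, rfl⟩ := c
    exact ⟨b * d, (skewConj_mul δ b d a).symm⟩⟩
  one_smul c := Subtype.ext (skewConj_one δ c)
  mul_smul b c x := Subtype.ext (skewConj_mul δ b c x)

/-- A set `A ⊆ K` is `(σ, δ)`-algebraic if some non-zero skew polynomial vanishes on it. -/
def IsSkewAlgebraic (δ : SkewDerivation σ) (A : Set K) : Prop :=
  ∃ P : SkewPoly σ δ, P ≠ 0 ∧ ∀ c ∈ A, P.eval c = 0

end SkewConvex

section SkewRational

variable {K : Type*} [DivisionRing K] {σ : K →+* K}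

open scoped nonZeroDivisors in
/-- The skew field `K(T; σ, δ)` of left fractions of `K[T; σ, δ]`. -/
abbrev SkewRat (δ : SkewDerivation σ) : Type _ :=
  OreLocalization (SkewPoly σ δ)⁰ (SkewPoly σ δ)

/-- The embedding of `K[T; σ, δ]` into `K(T; σ, δ)`. -/
abbrev SkewPoly.toRat {δ : SkewDerivation σ} : SkewPoly σ δ →+* SkewRat δ :=
  OreLocalization.numeratorRingHom

/-- `P⁻¹ Q` is the minimal representation of `f`: `P` is monic, and of least degree among the
denominators of all representations of `f`. -/
def IsMinimalRepr {δ : SkewDerivation σ} (f : SkewRat δ) (P Q : SkewPoly σ δ) : Prop :=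
  P.Monic ∧ f = P.toRat⁻¹ * Q.toRat ∧
    ∀ P' Q' : SkewPoly σ δ, P' ≠ 0 → f = P'.toRat⁻¹ * Q'.toRat → P.natDegree ≤ P'.natDegree

/-- `Def(a)`: the skew rational functions `f` that are defined at `a`, that is, the denominator of
the minimal representation of `f` is skew-invertible as a function on the class of `a`. -/
def defSet (δ : SkewDerivation σ) (a : K) : Set (SkewRat δ) :=
  {f | ∃ P Q : SkewPoly σ δ, IsMinimalRepr f P Q ∧
    SkewInvertible (fun c : conjClass δ a => P.eval (c : K))}

/-- Left Ore subsets `S` of a domain `R`: `S q ∩ R p ≠ ∅` for all `p ∈ S` and `q ∈ R`.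
Closure under products is not part of this notion, so that unions of left Ore subsets are left Ore
subsets. -/
def IsLeftOreSubset {R : Type*} [Ring R] (S : Set R) : Prop :=
  ∀ p ∈ S, ∀ q : R, ∃ s ∈ S, ∃ r : R, s * q = r * p

/-- The inverse of every monic irreducible factor of an element of `S` is defined at `a`. -/
def FactorsDefinedAt (δ : SkewDerivation σ) (a : K) (S : Set (SkewPoly σ δ)) : Prop :=
  ∀ P ∈ S, ∀ Q : SkewPoly σ δ, Q.Monic → Irreducible Q →
    (∃ Q₁ Q₂ : SkewPoly σ δ, P = Q₁ * Q * Q₂) → Q.toRat⁻¹ ∈ defSet δ a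

/-- `S(a)`: the largest left Ore subset of `K[T; σ, δ]` such that the inverses of all monic
irreducible factors of its elements are defined at `a`, obtained as the union of all of these. -/
def maxOreSet (δ : SkewDerivation σ) (a : K) : Set (SkewPoly σ δ) :=
  ⋃₀ {S | IsLeftOreSubset S ∧ FactorsDefinedAt δ a S}

theorem isGreatest_maxOreSet (δ : SkewDerivation σ) (a : K) :
    IsGreatest {S | IsLeftOreSubset S ∧ FactorsDefinedAt δ a S} (maxOreSet δ a) := by
  refine ⟨⟨?_, ?_⟩, fun S hS => Set.subset_sUnion_of_mem hS⟩
  · rintro p ⟨S, hS, hp⟩ q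
    obtain ⟨s, hs, r, h⟩ := hS.1 p hp q
    exact ⟨s, ⟨S, hS, hs⟩, r, h⟩
  · rintro P ⟨S, hS, hP⟩
    exact hS.2 P hP

/-- `Def_o(a)`: the Ore localization `S(a)⁻¹ K[T; σ, δ]`, inside `K(T; σ, δ)`. -/
def defOreSet (δ : SkewDerivation σ) (a : K) : Set (SkewRat δ) :=
  {f | ∃ P ∈ maxOreSet δ a, ∃ Q : SkewPoly σ δ, f = P.toRat⁻¹ * Q.toRat}

end SkewRational

end

/-! Write `R` for `K[T; σ, δ]` and `M` for the simple left module `R / R (T - a)`, realised on `K`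
as `EvalModule δ a`. For a unit `b` one has `P • b = P(ᵇa) b` (`smul_of_unit`). So `P` vanishes on
the class of `a` exactly when it lies in the annihilator `I` of `M`, and has no root there exactly
when it acts injectively on `M`.

If the class is algebraic, `I` contains some `F ≠ 0`, and `R / R F` is finite-dimensional over `K`.
Jacobson density then makes `M` finite over `D = End_R(M)` and `R → End_D(M)` surjective. Hence a
root-free `P` is invertible modulo `I` (`exists_smul_inverse`). It follows that root-free means skew
invertible, and that every factor of a root-free `P` is root-free.

The main point is that the root-free skew polynomials satisfy the left Ore condition
(`exists_mem_smul_mk_eq`). A monic generator `F` of `I` normalises the constants, so it acts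
semilinearly on the finite-dimensional space `R / R P`. Since `P` is invertible modulo `I`, the
image of this action spans. A dimension count shows that `F` then also has spanning image on the
submodule generated by `Q`, which gives `Q - G Q ∈ R P` with `G ∈ I`. The multiplier `1 - G` acts on
`M` as the identity, so it is root-free.

Conversely, a root `c` of `P` yields the irreducible right factor `T - c`, whose inverse is not
defined at `a`. Finally, the minimal denominator right-divides every other denominator, which
identifies `Def_o(a)` with `Def(a)`. -/

noncomputable section

/-! ### Evaluation and the simple module `R / R (T - a)`. -/

namespace SkewPoly

section Ring

variable {K : Type*} [Ring K] {σ : K →+* K} {δ : SkewDerivation σ}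

instance : IsScalarTower K (SkewPoly σ δ) (SkewPoly σ δ) :=
  ⟨fun b P Q => by simp only [smul_eq_mul, ← C_mul, mul_assoc]⟩

/-- The operator `x ↦ σ(x) a + δ(x)` by which `T` acts on the module `R / R (T - a)`. -/
def pseudoLinear (δ : SkewDerivation σ) (a : K) : AddMonoid.End K :=
  (AddMonoidHom.mulRight a).comp σ.toAddMonoidHom + δ.toAddMonoidHom

theorem pseudoLinear_apply (a x : K) : pseudoLinear δ a x = σ x * a + δ x := rfl

theorem eval_monomial (a : K) (n : ℕ) (b : K) :
    eval a (monomial n b : SkewPoly σ δ) = b * powEval δ a n := liftAdd_monomial _ n b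

theorem eval_smul (a b : K) (P : SkewPoly σ δ) : eval a (b • P) = b * eval a P := by
  induction P using induction_linear with
  | zero => simp
  | add F G hF hG => rw [smul_add, map_add, map_add, hF, hG, mul_add]
  | monomial n c => rw [smul_monomial, eval_monomial, eval_monomial, mul_assoc]

theorem eval_C (a b : K) : eval a (C b : SkewPoly σ δ) = b :=
  (eval_monomial a 0 b).trans (mul_one b)

theorem eval_one (a : K) : eval a (1 : SkewPoly σ δ) = 1 := eval_C a 1

theorem eval_T (a : K) : eval a (T σ δ) = a := by
  rw [T, eval_monomial, powEval, powEval, map_one, δ.map_one, one_mul, one_mul, add_zero]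

theorem eval_mulT (a : K) (P : SkewPoly σ δ) :
    eval a (mulT σ δ P) = pseudoLinear δ a (eval a P) := by
  induction P using induction_linear with
  | zero => simp
  | add F G hF hG => simp only [map_add, hF, hG]
  | monomial n b =>
    rw [mulT_monomial, map_add, eval_monomial, eval_monomial, eval_monomial, powEval,
      pseudoLinear_apply, map_mul, δ.leibniz]
    noncomm_ring

theorem eval_mulT_pow (a : K) (n : ℕ) (P : SkewPoly σ δ) :
    eval a ((mulT σ δ ^ n) P) = (pseudoLinear δ a ^ n) (eval a P) := by
  induction n with
  | zero => rfl
  | succ n ih =>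
    rw [pow_succ', pow_succ']
    change eval a (mulT σ δ ((mulT σ δ ^ n) P)) = pseudoLinear δ a ((pseudoLinear δ a ^ n) _)
    rw [eval_mulT, ih]

/-- The kernel of evaluation is a left ideal, because evaluation carries left multiplication by `T`
to `pseudoLinear`. This makes the action on `EvalModule` associative and underlies the product
formula. -/
theorem eval_mul_congr (a : K) (P : SkewPoly σ δ) {Q Q' : SkewPoly σ δ}
    (h : eval a Q = eval a Q') : eval a (P * Q) = eval a (P * Q') := by
  induction P using induction_linear with
  | zero => simp
  | add F G hF hG => rw [add_mul, add_mul, map_add, map_add, hF, hG]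
  | monomial n b =>
    rw [monomial_mul, monomial_mul, eval_smul, eval_smul, eval_mulT_pow, eval_mulT_pow, h]

end Ring

section Field

variable {K : Type*} [DivisionRing K] {σ : K →+* K} {δ : SkewDerivation σ}

/-- The simple left module `R / R (T - a)` over `R = K[T; σ, δ]`, realised on `K`. -/
@[nolint unusedArguments]
def EvalModule (_δ : SkewDerivation σ) (_a : K) : Type _ := K

namespace EvalModule

variable {a : K}

instance : AddCommGroup (EvalModule δ a) := inferInstanceAs (AddCommGroup K)
instance : Module K (EvalModule δ a) := inferInstanceAs (Module K K)
instance : Nontrivial (EvalModule δ a) := inferInstanceAs (Nontrivial K)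

variable (δ a) in
/-- The element of `EvalModule δ a` represented by the constant `x`. -/
def of (x : K) : EvalModule δ a := x

/-- The constant representing an element of `EvalModule δ a`. -/
def val (x : EvalModule δ a) : K := x

instance : SMul (SkewPoly σ δ) (EvalModule δ a) := ⟨fun P x => of δ a (eval a (P * C x.val))⟩

theorem smul_of (P : SkewPoly σ δ) (x : K) : P • of δ a x = of δ a (eval a (P * C x)) := rfl

instance : Module (SkewPoly σ δ) (EvalModule δ a) where
  one_smul x := by
    change eval a (1 * C x.val) = x.val
    rw [one_mul, eval_C]
  mul_smul P Q x := by
    change eval a (P * Q * C x.val) = eval a (P * C (eval a (Q * C x.val)))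
    rw [mul_assoc]
    exact eval_mul_congr a P (eval_C _ _).symm
  smul_zero P := by
    change eval a (P * C (0 : K)) = (0 : K)
    rw [map_zero, mul_zero, map_zero]
  smul_add P x y := by
    change eval a (P * C (x.val + y.val)) = eval a (P * C x.val) + eval a (P * C y.val)
    rw [map_add, mul_add, map_add]
  add_smul P Q x := by
    change eval a ((P + Q) * C x.val) = eval a (P * C x.val) + eval a (Q * C x.val)
    rw [add_mul, map_add]
  zero_smul x := by
    change eval a ((0 : SkewPoly σ δ) * C x.val) = (0 : K)
    rw [zero_mul, map_zero]

instance : IsScalarTower K (SkewPoly σ δ) (EvalModule δ a) :=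
  ⟨fun b P x => by
    change eval a (b • P * C x.val) = b * eval a (P * C x.val)
    rw [← smul_eq_mul (b • P), smul_assoc, eval_smul, smul_eq_mul]⟩

theorem C_smul_of (b x : K) : (C b : SkewPoly σ δ) • of δ a x = of δ a (b * x) := by
  rw [smul_of, C_mul, eval_smul, eval_C]

/-- The constants alone already move any non-zero element to any other element. -/
instance : IsSimpleModule (SkewPoly σ δ) (EvalModule δ a) :=
  isSimpleModule_iff_toSpanSingleton_surjective.mpr ⟨inferInstance, fun x hx y =>
    ⟨C (y.val * x.val⁻¹), (C_smul_of (y.val * x.val⁻¹) x.val).trans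
      (inv_mul_cancel_right₀ hx y.val)⟩⟩

instance : Module.Finite K (EvalModule δ a) := inferInstanceAs (Module.Finite K K)

end EvalModule

/-- Change of generator: right multiplication by `b` intertwines the operator of `T` at the
conjugate of `a` with the one at `a`. This is where the formula for the conjugate comes from. -/
theorem pseudoLinear_mul_skewConj (a y : K) (b : Kˣ) :
    pseudoLinear δ a (y * b) = (σ y * skewConj δ b a + δ y) * b := by
  have hb : (b : K)⁻¹ * b = 1 := inv_mul_cancel₀ b.ne_zero
  rw [pseudoLinear_apply, skewConj, map_mul, δ.leibniz]
  simp only [add_mul, mul_add, mul_assoc, hb, mul_one]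
  abel

theorem pseudoLinear_pow_unit (a : K) (b : Kˣ) (n : ℕ) :
    (pseudoLinear δ a ^ n) (b : K) = powEval δ (skewConj δ b a) n * b := by
  induction n with
  | zero => exact (one_mul _).symm
  | succ n ih =>
    rw [pow_succ']
    change pseudoLinear δ a ((pseudoLinear δ a ^ n) b) = _
    rw [ih, pseudoLinear_mul_skewConj, powEval]

/-- The product formula for evaluation at a conjugate, for a constant right factor. -/
theorem eval_mul_C (a : K) (b : Kˣ) (P : SkewPoly σ δ) :
    eval a (P * C (b : K)) = eval (skewConj δ b a) P * b := by
  induction P using induction_linear with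
  | zero => simp
  | add F G hF hG => rw [add_mul, map_add, map_add, hF, hG, add_mul]
  | monomial n c =>
    rw [monomial_mul, eval_smul, eval_mulT_pow, eval_C, pseudoLinear_pow_unit, eval_monomial,
      mul_assoc]

theorem smul_of_unit (a : K) (b : Kˣ) (P : SkewPoly σ δ) :
    P • EvalModule.of δ a b = EvalModule.of δ a (eval (skewConj δ b a) P * b) :=
  congrArg (EvalModule.of δ a) (eval_mul_C a b P)

end Field

end SkewPoly

/-! ### Consequences of Jacobson density for simple modules. -/

section Density

open Module (End)

variable {K R M : Type*} [DivisionRing K] [Ring R] [AddCommGroup M] [Module K R] [Module K M]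
  [Module R M] [IsScalarTower K R R] [IsScalarTower K R M]

/-- A simple module annihilated by a left ideal of finite codimension over a skew field is finite
over its endomorphism ring. -/
theorem Module.Finite.end_of_le_annihilator [IsSimpleModule R M] (J : Submodule R R)
    [Module.Finite K (R ⧸ J)] [Module.Finite K M] (hJ : ∀ r ∈ J, ∀ x : M, r • x = 0) :
    Module.Finite (End R M) M := by
  classical
  have := IsSimpleModule.nontrivial R M
  let b := Module.Basis.ofVectorSpace (End R M) M
  suffices _root_.Finite (Module.Basis.ofVectorSpaceIndex (End R M) M) from
    Module.Finite.of_basis b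
  by_contra hinf
  rw [not_finite_iff_infinite] at hinf
  -- One more than the codimension of `J`: by density, `n` vectors independent over the endomorphism
  -- ring give a surjection `R ⧸ J → Mⁿ`, whose target has `K`-dimension at least `n`.
  let n := Module.finrank K (R ⧸ J) + 1
  let e : Fin n ↪ Module.Basis.ofVectorSpaceIndex (End R M) M :=
    Fin.valEmbedding.trans (Infinite.natEmbedding _)
  let x : Fin n → M := fun i => b (e i)
  let ψ : R ⧸ J →ₗ[R] Fin n → M := J.liftQ (LinearMap.toSpanSingleton R (Fin n → M) x)
    fun r hr => funext fun i => hJ r hr (x i)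
  have hψ : Function.Surjective ψ := by
    intro y
    -- A map linear over the endomorphism ring with prescribed values `y i` on the chosen basis
    -- vectors; density realises it on these vectors by a ring element.
    let f : End (End R M) M := b.constr ℕ (Function.extend e y 0)
    obtain ⟨r, hr⟩ := jacobson_density f (Finset.univ.image x)
    refine ⟨J.mkQ r, funext fun i => ?_⟩
    change r • x i = y i
    rw [← hr _ (Finset.mem_image_of_mem x (Finset.mem_univ i)), Module.Basis.constr_basis,
      e.injective.extend_apply]
  have hle := LinearMap.finrank_le_finrank_of_surjective (f := ψ.restrictScalars K) hψ
  rw [Module.finrank_pi_fintype, Finset.sum_const, Finset.card_univ, Fintype.card_fin,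
    smul_eq_mul] at hle
  have : 0 < Module.finrank K M := Module.finrank_pos
  have := Nat.le_mul_of_pos_right n this
  omega

/-- Over a simple module that is finite over its endomorphism ring, a ring element acting
injectively is invertible modulo the annihilator. -/
theorem exists_smul_inverse_of_injective [IsSimpleModule R M] [Module.Finite (End R M) M] {p : R}
    (hp : Function.Injective fun x : M => p • x) :
    ∃ q : R, (∀ x : M, q • p • x = x) ∧ ∀ x : M, p • q • x = x := by
  classical
  let f : End (End R M) M := Module.toModuleEnd (End R M) (S := R) M p
  have hf : Function.Injective f := hp
  let e := LinearEquiv.ofInjectiveEndo f hf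
  -- By finiteness an injective endomorphism is bijective, and density lifts its inverse to `R`.
  obtain ⟨q, hq⟩ := Module.Finite.toModuleEnd_moduleEnd_surjective (R := R) (M := M) e.symm
  have hq' : ∀ x : M, q • x = e.symm x := fun x => LinearMap.congr_fun hq x
  refine ⟨q, fun x => ?_, fun x => ?_⟩
  · rw [hq']
    exact e.symm_apply_apply x
  · rw [hq']
    exact e.apply_symm_apply x

end Density

/-! ### Semilinear endomorphisms of finite-dimensional spaces. -/

section Semilinear

variable {K L : Type*} [DivisionRing K] [AddCommGroup L] [Module K L] [Module.Finite K L]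
  {τ : K →+* K}

/-- The images of a basis of `V` span. The span is needed because `τ` may fail to be surjective, so
that `φ '' V` need not be a subspace. -/
theorem Submodule.finrank_span_image_le (φ : L →ₛₗ[τ] L) (V : Submodule K L) :
    Module.finrank K (Submodule.span K (φ '' V)) ≤ Module.finrank K V := by
  let b := Module.finBasis K V
  have h : Submodule.span K (φ '' V) ≤ Submodule.span K (Set.range fun i => φ (b i)) := by
    refine Submodule.span_le.mpr ?_
    rintro _ ⟨x, hx, rfl⟩
    have := congrArg (fun y : V => φ y) (b.sum_repr ⟨x, hx⟩)
    simp only [Submodule.coe_sum, Submodule.coe_smul, map_sum, map_smulₛₗ] at this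
    rw [← this]
    exact Submodule.sum_mem _ fun i _ => Submodule.smul_mem _ _ (Submodule.subset_span ⟨i, rfl⟩)
  exact (Submodule.finrank_mono h).trans
    ((finrank_range_le_card (R := K) fun i => φ (b i)).trans (by simp))

/-- A semilinear endomorphism of a finite-dimensional space whose image spans maps every invariant
subspace to a spanning set of this subspace. -/
theorem Submodule.span_image_eq_of_span_range_eq_top (φ : L →ₛₗ[τ] L)
    (hφ : Submodule.span K (Set.range φ) = ⊤) (V : Submodule K L) (hV : ∀ x ∈ V, φ x ∈ V) :
    Submodule.span K (φ '' V) = V := by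
  have hle : Submodule.span K (φ '' V) ≤ V := by
    refine Submodule.span_le.mpr ?_
    rintro _ ⟨x, hx, rfl⟩
    exact hV x hx
  refine Submodule.eq_of_le_of_finrank_le hle ?_
  -- The complement `W` need not be invariant: it suffices that the spans of the images of `V` and
  -- `W` together fill `L` while that of `W` has dimension at most `dim W`.
  obtain ⟨W, hW⟩ := V.exists_isCompl
  have htop : Submodule.span K (φ '' V) ⊔ Submodule.span K (φ '' W) = ⊤ := by
    rw [eq_top_iff, ← hφ, Submodule.span_le]
    rintro _ ⟨x, rfl⟩
    have hx : x ∈ V ⊔ W := by rw [hW.sup_eq_top]; trivial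
    obtain ⟨v, hv, w, hw, rfl⟩ := Submodule.mem_sup.mp hx
    rw [map_add]
    exact Submodule.add_mem_sup (Submodule.subset_span ⟨v, hv, rfl⟩)
      (Submodule.subset_span ⟨w, hw, rfl⟩)
  have h1 := Submodule.finrank_add_le_finrank_add_finrank (Submodule.span K (φ '' V))
    (Submodule.span K (φ '' W))
  rw [htop, finrank_top, ← Submodule.finrank_add_eq_of_isCompl hW] at h1
  have h2 := Submodule.finrank_span_image_le φ W
  omega

end Semilinear

/-! ### Degrees, right division and left ideals. -/

namespace SkewPoly

section Ring

variable {K : Type*} [Ring K] {σ : K →+* K} {δ : SkewDerivation σ}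

theorem DegLT.mul {n m : ℕ} {P Q : SkewPoly σ δ} (hP : DegLT (n + 1) P) (hQ : DegLT (m + 1) Q) :
    DegLT (m + n + 1) (P * Q) := by
  intro k hk
  rw [mul_eq_sum, map_sum]
  refine Finset.sum_eq_zero fun i hi => ?_
  have hlt : i < n + 1 := by
    by_contra hcon
    exact Finsupp.mem_support_iff.mp hi (hP i (by omega))
  rw [coeff_smul, (mulT_pow_top hQ i).1 _ (by omega), mul_zero]

theorem DegLT.mono {n m : ℕ} {P : SkewPoly σ δ} (hP : DegLT n P) (h : n ≤ m) : DegLT m P :=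
  fun k hk => hP k (h.trans hk)

theorem DegLT.sub {n : ℕ} {P Q : SkewPoly σ δ} (hP : DegLT n P) (hQ : DegLT n Q) :
    DegLT n (P - Q) := fun k hk => by rw [map_sub, hP k hk, hQ k hk, sub_zero]

theorem DegLT.smul {n : ℕ} {P : SkewPoly σ δ} (hP : DegLT n P) (b : K) : DegLT n (b • P) :=
  fun k hk => by rw [coeff_smul, hP k hk, mul_zero]

theorem DegLT.of_coeff_eq_zero {n : ℕ} {P : SkewPoly σ δ} (hP : DegLT (n + 1) P)
    (h : coeff n P = 0) : DegLT n P := by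
  intro k hk
  rcases Nat.eq_or_lt_of_le hk with rfl | hlt
  · exact h
  · exact hP k hlt

theorem degLT_monomial (n : ℕ) (b : K) : DegLT (n + 1) (monomial n b : SkewPoly σ δ) :=
  fun k hk => by rw [coeff_monomial, if_neg (by omega)]

theorem degLT_zero_iff {P : SkewPoly σ δ} : DegLT 0 P ↔ P = 0 :=
  ⟨fun h => SkewPoly.ext fun k => h k (Nat.zero_le k), fun h k _ => by rw [h, map_zero]⟩

theorem degLT_natDegree (P : SkewPoly σ δ) : DegLT (P.natDegree + 1) P := by
  intro k hk
  by_contra h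
  have := Finset.le_sup (f := id) (Finsupp.mem_support_iff.mpr h : k ∈ Finsupp.support (M := K) P)
  change k ≤ natDegree P at this
  omega

theorem le_natDegree {n : ℕ} {P : SkewPoly σ δ} (h : coeff n P ≠ 0) : n ≤ P.natDegree :=
  Finset.le_sup (f := id) (Finsupp.mem_support_iff.mpr h : n ∈ Finsupp.support (M := K) P)

theorem natDegree_eq {n : ℕ} {P : SkewPoly σ δ} (h : DegLT (n + 1) P) (h0 : coeff n P ≠ 0) :
    P.natDegree = n := by
  refine le_antisymm (Finset.sup_le fun k hk => ?_) (le_natDegree h0)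
  by_contra hcon
  exact Finsupp.mem_support_iff.mp hk (h k (by simp only [id] at hcon; omega))

theorem C_eq_smul_one (b : K) : (C b : SkewPoly σ δ) = b • 1 := by rw [← C_mul, mul_one]

theorem C_mul_C (b c : K) : (C b * C c : SkewPoly σ δ) = C (b * c) := by
  rw [C_mul]
  exact smul_monomial b 0 c

end Ring

section Field

variable {K : Type*} [DivisionRing K] {σ : K →+* K} {δ : SkewDerivation σ}

theorem coeff_natDegree_ne_zero {P : SkewPoly σ δ} (hP : P ≠ 0) : coeff P.natDegree P ≠ 0 := by
  obtain ⟨n, hn, h0⟩ := exists_top hP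
  rwa [natDegree_eq hn h0]

theorem Monic.ne_zero {P : SkewPoly σ δ} (hP : P.Monic) : P ≠ 0 := by
  rintro rfl
  exact zero_ne_one ((map_zero _).symm.trans hP)

theorem natDegree_mul {P Q : SkewPoly σ δ} (hP : P ≠ 0) (hQ : Q ≠ 0) :
    (P * Q).natDegree = P.natDegree + Q.natDegree := by
  have hP' := degLT_natDegree P
  have hQ' := degLT_natDegree Q
  rw [natDegree_eq (hP'.mul hQ'), add_comm]
  rw [coeff_mul_top hP' hQ']
  exact mul_ne_zero (coeff_natDegree_ne_zero hP) (iterate_ne_zero _ (coeff_natDegree_ne_zero hQ))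

theorem natDegree_C (b : K) : (C b : SkewPoly σ δ).natDegree = 0 := by
  by_contra h
  have hne : (C b : SkewPoly σ δ) ≠ 0 := by
    rintro h0
    rw [h0] at h
    exact h rfl
  refine coeff_natDegree_ne_zero hne ?_
  rw [C, coeff_monomial, if_neg (fun h' => h h'.symm)]

theorem eq_C_of_natDegree_eq_zero {P : SkewPoly σ δ} (h : P.natDegree = 0) :
    P = C (coeff 0 P) := by
  refine SkewPoly.ext fun k => ?_
  rw [C, coeff_monomial]
  split_ifs with hk
  · rw [hk]
  · exact degLT_natDegree P k (by omega)

theorem isUnit_of_natDegree_eq_zero {P : SkewPoly σ δ} (hP : P ≠ 0) (h : P.natDegree = 0) :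
    IsUnit P := by
  have hc : coeff 0 P ≠ 0 := by
    have := coeff_natDegree_ne_zero hP
    rwa [h] at this
  rw [eq_C_of_natDegree_eq_zero h]
  exact ⟨⟨C (coeff 0 P), C (coeff 0 P)⁻¹, by rw [C_mul_C, mul_inv_cancel₀ hc]; rfl,
    by rw [C_mul_C, inv_mul_cancel₀ hc]; rfl⟩, rfl⟩

theorem natDegree_eq_zero_of_isUnit {P : SkewPoly σ δ} (h : IsUnit P) : P.natDegree = 0 := by
  obtain ⟨⟨P, Q, hPQ, hQP⟩, rfl⟩ := h
  have h0 : P * Q ≠ 0 := by rw [hPQ]; exact one_ne_zero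
  have := natDegree_mul (left_ne_zero_of_mul h0) (right_ne_zero_of_mul h0)
  rw [hPQ, one_def, show (monomial 0 1 : SkewPoly σ δ) = C 1 from rfl, natDegree_C] at this
  change P.natDegree = 0
  omega

theorem coeff_one_T_sub_C (c : K) : coeff 1 (T σ δ - C c) = 1 := by
  rw [map_sub, T, C, coeff_monomial, coeff_monomial, if_pos rfl, if_neg zero_ne_one, sub_zero]

theorem natDegree_T_sub_C (c : K) : (T σ δ - C c).natDegree = 1 := by
  refine natDegree_eq ((degLT_monomial 1 1).sub ((degLT_monomial 0 c).mono (by omega))) ?_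
  rw [coeff_one_T_sub_C]
  exact one_ne_zero

theorem monic_T_sub_C (c : K) : (T σ δ - C c).Monic := by
  rw [Monic, natDegree_T_sub_C, coeff_one_T_sub_C]

theorem irreducible_T_sub_C (c : K) : Irreducible (T σ δ - C c) := by
  refine ⟨fun h => ?_, fun P Q h => ?_⟩
  · have := natDegree_eq_zero_of_isUnit h
    rw [natDegree_T_sub_C] at this
    omega
  · have h0 : P * Q ≠ 0 := by rw [← h]; exact (monic_T_sub_C c).ne_zero
    have hP := left_ne_zero_of_mul h0
    have hQ := right_ne_zero_of_mul h0
    have hd := natDegree_mul hP hQ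
    rw [← h, natDegree_T_sub_C] at hd
    rcases Nat.eq_zero_or_pos P.natDegree with h1 | h1
    · exact Or.inl (isUnit_of_natDegree_eq_zero hP h1)
    · exact Or.inr (isUnit_of_natDegree_eq_zero hQ (by omega))

theorem eval_T_sub_C (c : K) : eval c (T σ δ - C c) = 0 := by
  rw [map_sub, eval_T, eval_C, sub_self]

theorem Monic.eq_of_mul {P Q A : SkewPoly σ δ} (hP : P.Monic) (hQ : Q.Monic) (h : P = A * Q)
    (hd : P.natDegree ≤ Q.natDegree) : P = Q := by
  have hA : A ≠ 0 := by
    rintro rfl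
    exact hP.ne_zero (by rw [h, zero_mul])
  have hdeg := natDegree_mul hA hQ.ne_zero
  rw [← h] at hdeg
  have hA0 := eq_C_of_natDegree_eq_zero (P := A) (by omega)
  have hc := hP
  rw [Monic, hdeg, show A.natDegree = 0 by omega, zero_add, h, hA0, C_mul, coeff_smul, hQ,
    mul_one] at hc
  rw [h, hA0, hc, C_mul, one_smul]

/-- Every non-zero left ideal is generated by a monic skew polynomial of least degree. -/
theorem exists_monic_generator (J : Submodule (SkewPoly σ δ) (SkewPoly σ δ))
    {P : SkewPoly σ δ} (hP : P ∈ J) (hP0 : P ≠ 0) :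
    ∃ F ∈ J, F.Monic ∧ (∀ G ∈ J, ∃ A, G = A * F) ∧
      ∀ G ∈ J, DegLT F.natDegree G → G = 0 := by
  classical
  have hex : ∃ n, ∃ F ∈ J, F ≠ 0 ∧ F.natDegree = n := ⟨_, P, hP, hP0, rfl⟩
  obtain ⟨F, hF, hF0, hn⟩ := Nat.find_spec hex
  have hmin : ∀ G ∈ J, DegLT F.natDegree G → G = 0 := by
    intro G hG hlt
    by_contra hG0
    have hlt' : G.natDegree < F.natDegree := by
      by_contra hcon
      exact coeff_natDegree_ne_zero hG0 (hlt _ (by omega))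
    exact Nat.find_min hex (hn ▸ hlt') ⟨G, hG, hG0, rfl⟩
  have hc := coeff_natDegree_ne_zero hF0
  let F' : SkewPoly σ δ := (coeff F.natDegree F)⁻¹ • F
  have htop : coeff F.natDegree F' = 1 := by
    rw [coeff_smul, inv_mul_cancel₀ hc]
  have hdeg : DegLT (F.natDegree + 1) F' := (degLT_natDegree F).smul _
  have hd : F'.natDegree = F.natDegree := natDegree_eq hdeg (by rw [htop]; exact one_ne_zero)
  have hF' : F' ∈ J := by
    change (coeff F.natDegree F)⁻¹ • F ∈ J
    rw [← C_mul]
    exact J.smul_mem _ hF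
  refine ⟨F', hF', by rw [Monic, hd, htop], fun G hG => ?_, by rwa [hd]⟩
  obtain ⟨N, hN⟩ := exists_degLT G
  obtain ⟨Q, hQ⟩ := exists_div hdeg (by rw [htop]; exact one_ne_zero) N G hN
  exact ⟨Q, sub_eq_zero.mp (hmin _ (J.sub_mem hG (J.smul_mem Q hF')) hQ)⟩

/-- `R / R P` is finite-dimensional over `K`. -/
theorem finite_quotient_span {P : SkewPoly σ δ} (hP : P ≠ 0) :
    Module.Finite K (SkewPoly σ δ ⧸ Submodule.span (SkewPoly σ δ) {P}) := by
  let J := Submodule.span (SkewPoly σ δ) {P}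
  let ψ : (Fin P.natDegree → K) →ₗ[K] SkewPoly σ δ ⧸ J :=
    Fintype.linearCombination K fun i => J.mkQ (monomial i 1)
  refine Module.Finite.of_surjective ψ fun y => ?_
  obtain ⟨Y, rfl⟩ := J.mkQ_surjective y
  obtain ⟨N, hN⟩ := exists_degLT Y
  obtain ⟨Q, hQ⟩ := exists_div (degLT_natDegree P) (coeff_natDegree_ne_zero hP) N Y hN
  -- The remainder has degree below that of `P`, so the powers of `T` below this degree span the
  -- quotient.
  let Z := Y - Q * P
  refine ⟨fun i => coeff i Z, ?_⟩
  have hZ : Z = ∑ i : Fin P.natDegree, coeff i Z • (monomial i 1 : SkewPoly σ δ) := by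
    refine SkewPoly.ext fun k => ?_
    rw [map_sum]
    simp only [coeff_smul, coeff_monomial]
    by_cases hk : k < P.natDegree
    · rw [Finset.sum_eq_single ⟨k, hk⟩]
      · simp
      · intro i _ hi
        rw [if_neg fun h => hi (Fin.ext h), mul_zero]
      · exact fun h => absurd (Finset.mem_univ _) h
    · rw [hQ k (by omega)]
      refine (Finset.sum_eq_zero fun i _ => ?_).symm
      rw [if_neg (by omega), mul_zero]
  have hYZ : J.mkQ Y = J.mkQ Z := by
    rw [← sub_eq_zero, ← map_sub]
    refine (Submodule.Quotient.mk_eq_zero J).mpr ?_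
    rw [sub_sub_cancel]
    exact J.smul_mem Q (Submodule.mem_span_singleton_self P)
  rw [hYZ]
  conv_rhs => rw [hZ, map_sum]
  rw [Fintype.linearCombination_apply]
  rfl

end Field

end SkewPoly

/-! ### Roots in the conjugacy class versus the action on `EvalModule`. -/

namespace SkewPoly

variable {K : Type*} [DivisionRing K] {σ : K →+* K} {δ : SkewDerivation σ} {a : K}

theorem forall_mem_conjClass_iff {p : K → Prop} :
    (∀ c ∈ conjClass δ a, p c) ↔ ∀ b : Kˣ, p (skewConj δ b a) :=
  ⟨fun h b => h _ ⟨b, rfl⟩, by rintro h _ ⟨b, rfl⟩; exact h b⟩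

namespace EvalModule

theorem eq_zero_or_exists_unit (x : EvalModule δ a) : x = 0 ∨ ∃ b : Kˣ, x = of δ a b :=
  or_iff_not_imp_left.mpr fun hx => ⟨Units.mk0 x.val hx, rfl⟩

theorem of_unit_ne_zero (b : Kˣ) : of δ a b ≠ 0 := b.ne_zero

theorem smul_of_unit_eq_zero_iff (b : Kˣ) (P : SkewPoly σ δ) :
    P • of δ a b = 0 ↔ eval (skewConj δ b a) P = 0 := by
  rw [smul_of_unit]
  exact mul_eq_zero_iff_right b.ne_zero

theorem mem_annihilator_iff {P : SkewPoly σ δ} :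
    P ∈ Module.annihilator (SkewPoly σ δ) (EvalModule δ a) ↔ ∀ c ∈ conjClass δ a, eval c P = 0 := by
  rw [Module.mem_annihilator, forall_mem_conjClass_iff]
  refine ⟨fun h b => (smul_of_unit_eq_zero_iff b P).mp (h _), fun h x => ?_⟩
  rcases eq_zero_or_exists_unit x with rfl | ⟨b, rfl⟩
  · exact smul_zero P
  · exact (smul_of_unit_eq_zero_iff b P).mpr (h b)

theorem forall_eval_ne_zero_iff {P : SkewPoly σ δ} :
    (∀ c ∈ conjClass δ a, eval c P ≠ 0) ↔ ∀ x : EvalModule δ a, P • x = 0 → x = 0 := by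
  rw [forall_mem_conjClass_iff]
  refine ⟨fun h x hx => ?_, fun h b hb => ?_⟩
  · rcases eq_zero_or_exists_unit x with rfl | ⟨b, rfl⟩
    · rfl
    · exact absurd ((smul_of_unit_eq_zero_iff b P).mp hx) (h b)
  · exact of_unit_ne_zero b (h _ ((smul_of_unit_eq_zero_iff b P).mpr hb))

/-- On an algebraic class, a skew polynomial without right roots acts invertibly. -/
theorem exists_smul_inverse (halg : IsSkewAlgebraic δ (conjClass δ a)) {P : SkewPoly σ δ}
    (hP : ∀ x : EvalModule δ a, P • x = 0 → x = 0) :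
    ∃ A : SkewPoly σ δ,
      (∀ x : EvalModule δ a, A • P • x = x) ∧ ∀ x : EvalModule δ a, P • A • x = x := by
  obtain ⟨F, hF0, hF⟩ := halg
  have := finite_quotient_span hF0
  have : Module.Finite (Module.End (SkewPoly σ δ) (EvalModule δ a)) (EvalModule δ a) :=
    Module.Finite.end_of_le_annihilator (K := K) (Submodule.span (SkewPoly σ δ) {F})
      fun r hr => Module.mem_annihilator.mp
        ((Submodule.span_singleton_le_iff_mem _ _).mpr (mem_annihilator_iff.mpr hF) hr)
  refine exists_smul_inverse_of_injective fun x y hxy => sub_eq_zero.mp (hP _ ?_)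
  rw [smul_sub]
  exact sub_eq_zero.mpr hxy

/-- Injectivity passes from `P` to its right factor `Q₂`, which is then also surjective on an
algebraic class. An element killed by the middle factor lifts through `Q₂` to one killed by `P`. -/
theorem forall_smul_eq_zero_of_mul_mul (halg : IsSkewAlgebraic δ (conjClass δ a))
    {P Q₁ Q Q₂ : SkewPoly σ δ} (hP : ∀ x : EvalModule δ a, P • x = 0 → x = 0)
    (h : P = Q₁ * Q * Q₂) (x : EvalModule δ a) (hx : Q • x = 0) : x = 0 := by
  have hQ₂ : ∀ y : EvalModule δ a, Q₂ • y = 0 → y = 0 := fun y hy =>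
    hP y (by rw [h, mul_smul, hy, smul_zero])
  obtain ⟨A, -, hA⟩ := exists_smul_inverse halg hQ₂
  rw [← hA x, hP (A • x) (by rw [h, mul_smul, hA, mul_smul, hx, smul_zero]), smul_zero]

end EvalModule

/-! ### The left Ore condition for root-free skew polynomials. -/

open EvalModule

/-- If `F` generates the annihilator of a module, then every element of the annihilator is a left
linear combination of right multiples of `F`. -/
theorem mem_span_range_mul {I : Submodule (SkewPoly σ δ) (SkewPoly σ δ)}
    (hI : ∀ G ∈ I, ∀ Q, G * Q ∈ I) {F : SkewPoly σ δ} (hFI : F ∈ I) (hF : F.Monic)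
    (hmin : ∀ G ∈ I, DegLT F.natDegree G → G = 0) {G : SkewPoly σ δ} (hG : G ∈ I) :
    G ∈ Submodule.span K (Set.range fun Q => F * Q) := by
  obtain ⟨N, hN⟩ := exists_degLT G
  induction N generalizing G with
  | zero =>
    rw [degLT_zero_iff.mp hN]
    exact zero_mem _
  | succ N ih =>
    by_cases hd : N < F.natDegree
    · rw [hmin G hG (hN.mono (by omega))]
      exact zero_mem _
    obtain ⟨d, rfl⟩ : ∃ d, N = d + F.natDegree := ⟨N - F.natDegree, by omega⟩
    -- The leading coefficient is supplied from the left: a coefficient placed to the right of `F`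
    -- would appear only through a power of `σ`, which need not be surjective.
    let H : SkewPoly σ δ := coeff (d + F.natDegree) G • (F * monomial d 1)
    have hHI : H ∈ I := by
      change _ • _ ∈ I
      rw [← C_mul]
      exact I.smul_mem _ (hI F hFI _)
    have hH : coeff (d + F.natDegree) H = coeff (d + F.natDegree) G := by
      rw [coeff_smul, coeff_mul_top (degLT_natDegree F) (degLT_monomial d 1), hF, coeff_monomial,
        if_pos rfl, ← RingHom.coe_pow, map_one, mul_one, mul_one]
    have h1 : G - H ∈ Submodule.span K (Set.range fun Q => F * Q) := by
      refine ih (I.sub_mem hG hHI) (DegLT.of_coeff_eq_zero (hN.sub ?_) ?_)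
      · exact ((degLT_natDegree F).mul (degLT_monomial d 1)).smul _
      · rw [map_sub, hH, sub_self]
    have h2 : H ∈ Submodule.span K (Set.range fun Q => F * Q) :=
      Submodule.smul_mem _ _ (Submodule.subset_span ⟨_, rfl⟩)
    simpa using add_mem h1 h2

/-- The difference of the two sides lies in `I` and its leading terms cancel, so minimality of the
degree of `F` forces it to vanish. -/
theorem mul_C_eq_C_mul {I : Submodule (SkewPoly σ δ) (SkewPoly σ δ)}
    (hI : ∀ G ∈ I, ∀ Q, G * Q ∈ I) {F : SkewPoly σ δ} (hFI : F ∈ I) (hF : F.Monic)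
    (hmin : ∀ G ∈ I, DegLT F.natDegree G → G = 0) (b : K) :
    F * C b = C ((σ ^ F.natDegree) b) * F := by
  refine sub_eq_zero.mp (hmin _ (I.sub_mem (hI F hFI _) (I.smul_mem _ hFI)) ?_)
  have hdeg := (degLT_natDegree F).mul (degLT_monomial 0 b)
  rw [zero_add] at hdeg
  refine DegLT.of_coeff_eq_zero (hdeg.sub (by
    rw [C_mul]
    exact (degLT_natDegree F).smul _)) ?_
  have htop := coeff_mul_top (degLT_natDegree F) (degLT_monomial 0 b)
  rw [zero_add, hF, one_mul, coeff_monomial, if_pos rfl, ← RingHom.coe_pow] at htop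
  rw [map_sub, C_mul, coeff_smul, hF, mul_one, sub_eq_zero]
  exact htop

/-- Left multiplication by a monic skew polynomial `F` that normalises the constants, as a
semilinear map. -/
def mulSemilinear (L : Type*) [AddCommGroup L] [Module K L] [Module (SkewPoly σ δ) L]
    [IsScalarTower K (SkewPoly σ δ) L] (F : SkewPoly σ δ) (τ : K →+* K)
    (h : ∀ b : K, F * C b = C (τ b) * F) : L →ₛₗ[τ] L where
  toFun x := F • x
  map_add' x y := smul_add F x y
  map_smul' b x := by
    have hC : ∀ (c : K) (y : L), c • y = (C c : SkewPoly σ δ) • y := fun c y => by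
      rw [C_eq_smul_one, smul_assoc, one_smul]
    rw [hC, hC, ← mul_smul, ← mul_smul, h]

/-- If `P` is invertible modulo a two-sided ideal `I`, then every element of `R / R P` is fixed by
an element of `I`. -/
theorem exists_mem_smul_mk_eq {I : Submodule (SkewPoly σ δ) (SkewPoly σ δ)}
    (hI : ∀ G ∈ I, ∀ Q, G * Q ∈ I) (hI0 : I ≠ ⊥) {P A : SkewPoly σ δ} (hP : P ≠ 0)
    (hA : 1 - A * P ∈ I) (Q : SkewPoly σ δ) :
    ∃ G ∈ I, ∃ B, Q - G * Q = B * P := by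
  obtain ⟨F₀, hF₀, hF₀0⟩ := I.ne_bot_iff.mp hI0
  obtain ⟨F, hFI, hF, -, hmin⟩ := exists_monic_generator I hF₀ hF₀0
  let J := Submodule.span (SkewPoly σ δ) {P}
  have := finite_quotient_span hP
  let φ := mulSemilinear (SkewPoly σ δ ⧸ J) F _ (mul_C_eq_C_mul hI hFI hF hmin)
  have hφ : Submodule.span K (Set.range φ) = ⊤ := by
    refine eq_top_iff.mpr fun y _ => ?_
    obtain ⟨Y, rfl⟩ := J.mkQ_surjective y
    -- Modulo `R P`, every `Y` is represented by an element of `I`, hence by a left `K`-combination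
    -- of products `F * Z`, whose classes are values of `φ`.
    have hY : J.mkQ Y = (J.mkQ.restrictScalars K) (Y * (1 - A * P)) := by
      change J.mkQ Y = J.mkQ _
      rw [← sub_eq_zero, ← map_sub]
      refine (Submodule.Quotient.mk_eq_zero J).mpr ?_
      rw [mul_sub, mul_one, sub_sub_cancel, ← mul_assoc]
      exact J.smul_mem _ (Submodule.mem_span_singleton_self P)
    have hmem := Submodule.mem_map_of_mem (f := J.mkQ.restrictScalars K)
      (mem_span_range_mul hI hFI hF hmin (I.smul_mem Y hA))
    rw [hY]
    rw [Submodule.map_span] at hmem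
    refine Submodule.span_mono ?_ hmem
    rintro _ ⟨_, ⟨Z, rfl⟩, rfl⟩
    exact ⟨J.mkQ Z, rfl⟩
  let V : Submodule (SkewPoly σ δ) (SkewPoly σ δ ⧸ J) :=
    Submodule.span (SkewPoly σ δ) {J.mkQ Q}
  have hV := Submodule.span_image_eq_of_span_range_eq_top φ hφ (V.restrictScalars K)
    fun x hx => V.smul_mem F hx
  have hmem : J.mkQ Q ∈ V.restrictScalars K := Submodule.mem_span_singleton_self (J.mkQ Q)
  rw [← hV] at hmem
  -- The class of `Q` lies in the `K`-span of `F • V`, and each element of `V` is a multiple `Z •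
  -- Q`; since `F * Z ∈ I`, the coefficients collect into one element of `I`.
  have key : ∃ G ∈ I, J.mkQ Q = G • J.mkQ Q := by
    refine Submodule.span_induction (p := fun x _ => ∃ G ∈ I, x = G • J.mkQ Q) ?_
      ⟨0, I.zero_mem, (zero_smul _ _).symm⟩ ?_ ?_ hmem
    · rintro _ ⟨x, hx, rfl⟩
      obtain ⟨Z, rfl⟩ := Submodule.mem_span_singleton.mp (show x ∈ V from hx)
      exact ⟨F * Z, hI F hFI Z, (mul_smul F Z _).symm⟩
    · rintro _ _ - - ⟨G, hG, rfl⟩ ⟨G', hG', rfl⟩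
      exact ⟨G + G', I.add_mem hG hG', (add_smul _ _ _).symm⟩
    · rintro b _ - ⟨G, hG, rfl⟩
      refine ⟨b • G, ?_, (smul_assoc _ _ _).symm⟩
      rw [← C_mul]
      exact I.smul_mem _ hG
  obtain ⟨G, hG, hGQ⟩ := key
  have h0 : J.mkQ (Q - G * Q) = 0 := by
    rw [map_sub, sub_eq_zero]
    exact hGQ
  obtain ⟨B, hB⟩ := Submodule.mem_span_singleton.mp ((Submodule.Quotient.mk_eq_zero J).mp h0)
  exact ⟨G, hG, B, hB.symm⟩

theorem isLeftOreSubset_forall_eval_ne_zero (halg : IsSkewAlgebraic δ (conjClass δ a)) :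
    IsLeftOreSubset {P : SkewPoly σ δ | ∀ c ∈ conjClass δ a, eval c P ≠ 0} := by
  intro P hP Q
  have hP' := forall_eval_ne_zero_iff.mp hP
  obtain ⟨A, hA, -⟩ := exists_smul_inverse halg hP'
  obtain ⟨F, hF0, hF⟩ := halg
  have hP0 : P ≠ 0 := by
    rintro rfl
    exact one_ne_zero (α := K) (hP' (of δ a 1) (zero_smul _ _))
  obtain ⟨G, hG, B, hB⟩ := exists_mem_smul_mk_eq
    (I := Module.annihilator (SkewPoly σ δ) (EvalModule δ a)) (A := A)
    (fun G hG Q => Module.mem_annihilator.mpr fun x => by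
      rw [mul_smul, Module.mem_annihilator.mp hG])
    ((Submodule.ne_bot_iff _).mpr ⟨F, mem_annihilator_iff.mpr hF, hF0⟩) hP0
    (Module.mem_annihilator.mpr fun x => by rw [sub_smul, one_smul, mul_smul, hA, sub_self]) Q
  -- As `G` annihilates the module, `1 - G` acts as the identity and so has no root in the class.
  refine ⟨1 - G, forall_eval_ne_zero_iff.mpr fun x hx => ?_, B, ?_⟩
  · rwa [sub_smul, one_smul, Module.mem_annihilator.mp hG, sub_zero] at hx
  · rw [sub_mul, one_mul, hB]

end SkewPoly

open SkewPoly

/-! ### Skew invertibility of polynomial functions. -/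

section SkewInvertible

variable {K : Type*} [DivisionRing K] {σ : K →+* K} {δ : SkewDerivation σ} {a : K}

/-- The product formula: evaluation turns products into skew products. -/
theorem skewMul_eval (P Q : SkewPoly σ δ) :
    skewMul (fun c : conjClass δ a => P.eval (c : K)) (fun c => Q.eval (c : K)) =
      fun c : conjClass δ a => (P * Q).eval (c : K) := by
  funext c
  have h := eval_mul_congr (c : K) P (eval_C (c : K) (Q.eval (c : K))).symm
  rw [h, skewMul]
  split_ifs with h0
  · rw [h0, map_zero, mul_zero, map_zero]
  · exact (eval_mul_C (c : K) (Units.mk0 _ h0) P).symm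

/-- By convention `g ⋄ f` is `0` wherever `f` is, which is incompatible with a left inverse. -/
theorem ne_zero_of_skewInvertible {X : Type*} [MulAction Kˣ X] {f : X → K}
    (h : SkewInvertible f) (x : X) : f x ≠ 0 := by
  obtain ⟨g, -, hg⟩ := h
  intro h0
  have := congrFun hg x
  rw [skewMul, dif_pos h0] at this
  exact zero_ne_one this

/-- The skew inverse is itself polynomial: an inverse `A` of `P` modulo the annihilator works, since
skew polynomials acting as the identity take the value `1` on the whole class. -/
theorem skewInvertible_eval_iff (halg : IsSkewAlgebraic δ (conjClass δ a)) {P : SkewPoly σ δ} :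
    SkewInvertible (fun c : conjClass δ a => P.eval (c : K)) ↔
      ∀ c ∈ conjClass δ a, P.eval c ≠ 0 := by
  refine ⟨fun h c hc => ne_zero_of_skewInvertible h ⟨c, hc⟩, fun h => ?_⟩
  obtain ⟨A, hA, hA'⟩ := EvalModule.exists_smul_inverse halg
    (EvalModule.forall_eval_ne_zero_iff.mp h)
  have key : ∀ B : SkewPoly σ δ, (∀ x : EvalModule δ a, B • x = x) →
      ∀ c : conjClass δ a, B.eval (c : K) = 1 := fun B hB c => by
    have hmem : B - 1 ∈ Module.annihilator (SkewPoly σ δ) (EvalModule δ a) :=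
      Module.mem_annihilator.mpr fun x => by rw [sub_smul, one_smul, hB, sub_self]
    have h1 := EvalModule.mem_annihilator_iff.mp hmem c c.2
    rwa [map_sub, eval_one, sub_eq_zero] at h1
  refine ⟨fun c => A.eval (c : K), ?_, ?_⟩
  · rw [skewMul_eval]
    exact funext (key _ fun x => by rw [mul_smul, hA'])
  · rw [skewMul_eval]
    exact funext (key _ fun x => by rw [mul_smul, hA])

end SkewInvertible

/-! ### Minimal representations, `S(a)` and `Def(a)`. -/

section SkewRational

variable {K : Type*} [DivisionRing K] {σ : K →+* K} {δ : SkewDerivation σ} {a : K}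

theorem SkewPoly.toRat_injective :
    Function.Injective (toRat : SkewPoly σ δ →+* SkewRat δ) :=
  OreLocalization.numeratorHom_inj inf_le_left

theorem SkewPoly.toRat_ne_zero {P : SkewPoly σ δ} (hP : P ≠ 0) : P.toRat ≠ 0 :=
  (map_ne_zero_iff _ toRat_injective).mpr hP

theorem eq_inv_mul_toRat_iff {f : SkewRat δ} {P Q : SkewPoly σ δ} (hP : P ≠ 0) :
    f = P.toRat⁻¹ * Q.toRat ↔ P.toRat * f = Q.toRat :=
  eq_inv_mul_iff_mul_eq₀ (toRat_ne_zero hP)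

/-- The left ideal of the denominators of a skew rational function. -/
def denominators (f : SkewRat δ) : Submodule (SkewPoly σ δ) (SkewPoly σ δ) where
  carrier := {P | ∃ Q : SkewPoly σ δ, P.toRat * f = Q.toRat}
  zero_mem' := ⟨0, by rw [map_zero, zero_mul]⟩
  add_mem' := by
    rintro P P' ⟨Q, hQ⟩ ⟨Q', hQ'⟩
    exact ⟨Q + Q', by rw [map_add, map_add, add_mul, hQ, hQ']⟩
  smul_mem' := by
    rintro A P ⟨Q, hQ⟩
    exact ⟨A * Q, by rw [smul_eq_mul, map_mul, map_mul, mul_assoc, hQ]⟩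

/-- The denominator of the minimal representation divides every other denominator. -/
theorem exists_isMinimalRepr {P Q : SkewPoly σ δ} (hP : P ≠ 0) :
    ∃ P₀ Q₀ A : SkewPoly σ δ, IsMinimalRepr (P.toRat⁻¹ * Q.toRat) P₀ Q₀ ∧ P = A * P₀ := by
  have hmem : P ∈ denominators (P.toRat⁻¹ * Q.toRat) := ⟨Q, (eq_inv_mul_toRat_iff hP).mp rfl⟩
  obtain ⟨P₀, ⟨Q₀, h₀⟩, hmonic, hgen, hmin⟩ := exists_monic_generator _ hmem hP
  obtain ⟨A, hA⟩ := hgen P hmem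
  refine ⟨P₀, Q₀, A, ⟨hmonic, (eq_inv_mul_toRat_iff hmonic.ne_zero).mpr h₀, ?_⟩, hA⟩
  intro P' Q' hP' h'
  by_contra hlt
  refine hP' (hmin P' ⟨Q', (eq_inv_mul_toRat_iff hP').mp h'⟩ ?_)
  exact (degLT_natDegree P').mono (by omega)

theorem exists_eq_mul_of_inv_eq {P P' Q' : SkewPoly σ δ} (hP : P ≠ 0) (hP' : P' ≠ 0)
    (h : P.toRat⁻¹ = P'.toRat⁻¹ * Q'.toRat) : P' = Q' * P := by
  apply toRat_injective
  rw [map_mul, ← (eq_inv_mul_toRat_iff hP').mp h, mul_assoc, inv_mul_cancel₀ (toRat_ne_zero hP),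
    mul_one]

/-- The minimal representation of `P⁻¹`, for `P` monic. -/
theorem isMinimalRepr_inv {P : SkewPoly σ δ} (hP : P.Monic) : IsMinimalRepr P.toRat⁻¹ P 1 := by
  refine ⟨hP, by rw [map_one, mul_one], fun P' Q' hP' h => ?_⟩
  have h' := exists_eq_mul_of_inv_eq hP.ne_zero hP' h
  rw [h', natDegree_mul (by rintro rfl; exact hP' (by rw [h', zero_mul])) hP.ne_zero]
  omega

theorem IsMinimalRepr.eq_of_inv {P P' Q' : SkewPoly σ δ} (hP : P.Monic)
    (h : IsMinimalRepr P.toRat⁻¹ P' Q') : P' = P :=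
  h.1.eq_of_mul hP (exists_eq_mul_of_inv_eq hP.ne_zero h.1.ne_zero h.2.1)
    (h.2.2 P 1 hP.ne_zero (by rw [map_one, mul_one]))

/-- A root `c` makes `T - c` a monic irreducible factor. It is the minimal denominator of its own
inverse and vanishes at `c`, so that inverse is not defined at `a`. -/
theorem eval_ne_zero_of_factorsDefinedAt {S : Set (SkewPoly σ δ)} (hS : FactorsDefinedAt δ a S)
    {P : SkewPoly σ δ} (hP : P ∈ S) {c : K} (hc : c ∈ conjClass δ a) : P.eval c ≠ 0 := by
  intro h0
  obtain ⟨Q, hQ⟩ := exists_sub_eval_eq_mul c P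
  rw [h0, map_zero, sub_zero] at hQ
  obtain ⟨P', Q', hmin, hinv⟩ := hS P hP (T σ δ - C c) (monic_T_sub_C c) (irreducible_T_sub_C c)
    ⟨Q, 1, by rw [mul_one, hQ]⟩
  rw [hmin.eq_of_inv (monic_T_sub_C c)] at hinv
  exact ne_zero_of_skewInvertible hinv ⟨c, hc⟩ (eval_T_sub_C c)

theorem factorsDefinedAt_forall_eval_ne_zero (halg : IsSkewAlgebraic δ (conjClass δ a)) :
    FactorsDefinedAt δ a {P : SkewPoly σ δ | ∀ c ∈ conjClass δ a, P.eval c ≠ 0} := by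
  rintro P hP Q hQ - ⟨Q₁, Q₂, h⟩
  exact ⟨Q, 1, isMinimalRepr_inv hQ, (skewInvertible_eval_iff halg).mpr
    (EvalModule.forall_eval_ne_zero_iff.mpr (EvalModule.forall_smul_eq_zero_of_mul_mul halg
      (EvalModule.forall_eval_ne_zero_iff.mp hP) h))⟩

/-- The root-free set is itself one of the sets over which the union `S(a)` is taken, and it
contains all the others. -/
theorem maxOreSet_eq (halg : IsSkewAlgebraic δ (conjClass δ a)) :
    maxOreSet δ a = {P : SkewPoly σ δ | ∀ c ∈ conjClass δ a, P.eval c ≠ 0} := by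
  refine Set.Subset.antisymm ?_ ?_
  · exact fun P hP c hc => eval_ne_zero_of_factorsDefinedAt (isGreatest_maxOreSet δ a).1.2 hP hc
  · exact (isGreatest_maxOreSet δ a).2
      ⟨isLeftOreSubset_forall_eval_ne_zero halg, factorsDefinedAt_forall_eval_ne_zero halg⟩

variable (δ a) in
/-- The skew polynomials without right roots in the class of `a`, as a submonoid. -/
def rootFreeSubmonoid : Submonoid (SkewPoly σ δ) where
  carrier := {P | ∀ c ∈ conjClass δ a, P.eval c ≠ 0}
  one_mem' c _ := by
    rw [eval_one]
    exact one_ne_zero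
  mul_mem' {P Q} hP hQ := EvalModule.forall_eval_ne_zero_iff.mpr fun x hx => by
    rw [mul_smul] at hx
    exact EvalModule.forall_eval_ne_zero_iff.mp hQ x
      (EvalModule.forall_eval_ne_zero_iff.mp hP _ hx)

theorem defOreSet_eq_defSet (halg : IsSkewAlgebraic δ (conjClass δ a)) :
    defOreSet δ a = defSet δ a := by
  have hself : a ∈ conjClass δ a := ⟨1, (skewConj_one δ a).symm⟩
  refine Set.Subset.antisymm ?_ ?_
  · rintro _ ⟨P, hP, Q, rfl⟩
    rw [maxOreSet_eq halg] at hP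
    have hP0 : P ≠ 0 := by
      rintro rfl
      exact hP a hself (map_zero _)
    obtain ⟨P₀, Q₀, A, hmin, hA⟩ := exists_isMinimalRepr (Q := Q) hP0
    refine ⟨P₀, Q₀, hmin, (skewInvertible_eval_iff halg).mpr
      (EvalModule.forall_eval_ne_zero_iff.mpr fun x hx => ?_)⟩
    -- The minimal denominator `P₀` is a right factor of `P`, so whatever it kills is killed by `P`.
    refine EvalModule.forall_eval_ne_zero_iff.mp hP x ?_
    rw [hA, mul_smul, hx, smul_zero]
  · rintro f ⟨P, Q, hmin, hinv⟩
    refine ⟨P, ?_, Q, hmin.2.1⟩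
    rw [maxOreSet_eq halg]
    exact (skewInvertible_eval_iff halg).mp hinv

end SkewRational

end

theorem mainTheorem3 {K : Type*} [DivisionRing K] (σ : K →+* K) (δ : SkewDerivation σ) (a : K)
    (halg : IsSkewAlgebraic δ (conjClass δ a)) :
    (∀ P : SkewPoly σ δ, P ∈ maxOreSet δ a ↔ ∀ c ∈ conjClass δ a, P.eval c ≠ 0) ∧
    (∃ M : Submonoid (SkewPoly σ δ),
      (M : Set (SkewPoly σ δ)) = maxOreSet δ a ∧ Nonempty (OreLocalization.OreSet M)) ∧
    defOreSet δ a = defSet δ a := by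
  refine ⟨fun P => by rw [maxOreSet_eq halg]; rfl,
    ⟨rootFreeSubmonoid δ a, (maxOreSet_eq halg).symm, ?_⟩, defOreSet_eq_defSet halg⟩
  -- In a domain the cancellation part of the Ore axioms is automatic, so only common left multiples
  -- are needed.
  refine OreLocalization.nonempty_oreSet_iff_of_noZeroDivisors.mpr fun Q P => ?_
  obtain ⟨S, hS, B, h⟩ := SkewPoly.isLeftOreSubset_forall_eval_ne_zero halg P P.2 Q
  exact ⟨B, ⟨S, hS⟩, h⟩
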